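/- **Setting.** Let $1\le K\le N$ be integers. There are agents $\mathcal K=\{1,\dots,K\}$ and indivisible goods $\mathcal N=\{1,\dots,N\}$; let $\mathcal M$ be the set of injective maps $\phi:\mathcal K\to\mathcal N$ (allocations). Let $\mu^j_i\in\mathbb R$ be the unknown true reward of agent $j$ from good $i$, and put $\mu_{\max\min}=\max_{\phi\in\mathcal M}\min_{j\in\mathcal K}\mu^j_{\phi(j)}$. At each epoch $t=1,2,\dots$ the platform selects an allocation $\phi_t\in\mathcal M$ and one agent-good pair $I_t=(j,i)$ (an arm), and observes only $X_{ij}(t)=\mu^j_i+\epsilon_{ij}(t)$ for that pair. The noise arrays $(\epsilon_{ij}(t))_{i,j}$, $t=1,2,\dots$, are independent and identically distributed across $t$, and each $\epsilon_{ij}(t)$ is centred and $\sigma^2$-subgaussian, i.e. $\mathbb E\,e^{s\epsilon_{ij}(t)}\le e^{\sigma^2s^2/2}$ for all $s\in\mathbb R$, where $\sigma>0$. **Dueling ULCB** (with parameters $\sigma$ and $\alpha>2$). In epochs $t=1,\dots,NK$ every arm is pulled once, in a fixed order, with arbitrary fixed allocations $\phi_t\in\mathcal M$ in these epochs. In every epoch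 $t>NK$, let $T^j_i(t-1)$ be the number of epochs $s\le t-1$ with $I_s=(j,i)$, let $\hat\mu^j_i(t)$ be the average of the rewards observed from that arm in these epochs, and set $$\bar\nu^j_i(t)=\hat\mu^j_i(t)+\sqrt{\frac{2\sigma^2\log t^{\alpha}}{T^j_i(t-1)}},\qquad \underline\nu^j_i(t)=\hat\mu^j_i(t)-\sqrt{\frac{2\sigma^2\log t^{\alpha}}{T^j_i(t-1)}} .$$ Choose $\phi_t\in\arg\max_{\phi\in\mathcal M}\min_{j\in\mathcal K}\bar\nu^j_{\phi(j)}(t)$, then $j_t\in\arg\min_{j\in\mathcal K}\underline\nu^j_{\phi_t(j)}(t)$, and pull $I_t=(j_t,\phi_t(j_t))$; ties are broken by any fixed measurable rules. **Proposition.** Suppose that $\Delta_{\max}>0$ and $|\mu^{j_1}_{i_1}-\mu^{j_2}_{i_2}|\le\Delta_{\max}$ for all $i_1,i_2\in\mathcal N$ and $j_1,j_2\in\mathcal K$ (no gap between optimal and suboptimal allocations is assumed). Then for every horizon $T$ the expected cumulative regret $R_T=\mathbb E\big[\sum_{t=1}^{T}\big(\mu_{\max\min}-\min_{j\in\mathcal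 K}\mu^j_{\phi_t(j)}\big)\big]$ of Dueling ULCB is well defined and satisfies $$R_T\le 6\,\Delta_{\max}NK\left[\frac{\alpha-1}{\alpha-2}+1\right]+4.5^{2/3}\left(\Delta_{\max}NK\,(\sqrt{2\alpha}+2)^2\sigma^2\log T\right)^{1/3}T^{2/3}.$$ -/

import Mathlib

open MeasureTheory ProbabilityTheory

namespace FairBandit

/-- An allocation gives every one of the `K` agents exactly one of the `N` indivisible goods, and
no good to two agents. -/
abbrev Allocation (K N : ℕ) := Fin K ↪ Fin N

/-- An arm is an agent-good pair. -/
abbrev Arm (K N : ℕ) := Fin K × Fin N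

/-- The reward of the worst-off agent under the allocation `φ`, where `x j i` is the reward of
agent `j` from good `i`. -/
noncomputable def minReward {K N : ℕ} (x : Fin K → Fin N → ℝ) (φ : Allocation K N) : ℝ :=
  ⨅ j, x j (φ j)

/-- The optimal max-min objective. -/
noncomputable def maxMin {K N : ℕ} (x : Fin K → Fin N → ℝ) : ℝ :=
  ⨆ φ : Allocation K N, minReward x φ

/-- A (measurable) oracle that solves the static max-min problem for every matrix. -/
structure IsMaxMinOracle {K N : ℕ} (O : (Fin K → Fin N → ℝ) → Allocation K N) : Prop where
  optimal : ∀ (x : Fin K → Fin N → ℝ) (φ : Allocation K N), minReward x φ ≤ minReward x (O x)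
  measurable : ∀ φ, MeasurableSet (O ⁻¹' {φ})

/-- A (measurable) oracle that returns, for an allocation `φ` and a matrix, an agent whose entry is
the lowest among the entries selected by `φ`. -/
structure IsMinOracle {K N : ℕ} (O : Allocation K N → (Fin K → Fin N → ℝ) → Fin K) : Prop where
  minimal : ∀ (φ : Allocation K N) (x : Fin K → Fin N → ℝ) (j : Fin K), x (O φ x) (φ (O φ x)) ≤ x j (φ j)
  measurable : ∀ φ, Measurable (O φ)

/-- What has to be fixed to run the algorithm: its two numerical inputs, the order in which the
`N * K` arms are pulled in the initial phase, the allocations in force during that phase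
(the algorithm leaves both free), and the two oracles. -/
structure Config (K N : ℕ) where
  σ : ℝ
  α : ℝ
  initArm : Fin (N * K) ≃ Arm K N
  initAlloc : Fin (N * K) → Allocation K N
  oracle₁ : (Fin K → Fin N → ℝ) → Allocation K N
  oracle₂ : Allocation K N → (Fin K → Fin N → ℝ) → Fin K

/-- Number of pulls of every arm, and sum of the rewards observed from every arm, so far. -/
structure Stats (K N : ℕ) where
  pulls : Fin K → Fin N → ℕ
  total : Fin K → Fin N → ℝ

namespace Stats

variable {K N : ℕ}

/-- Nothing has been pulled. -/
def empty : Stats K N := ⟨fun _ _ => 0, fun _ _ => 0⟩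

/-- Record the reward `y` observed from the arm `a`. -/
noncomputable def record (s : Stats K N) (a : Arm K N) (y : ℝ) : Stats K N where
  pulls j i := if (j, i) = a then s.pulls j i + 1 else s.pulls j i
  total j i := if (j, i) = a then s.total j i + y else s.total j i

/-- Average of the observed rewards. -/
noncomputable def empMean (s : Stats K N) (j : Fin K) (i : Fin N) : ℝ :=
  s.total j i / s.pulls j i

/-- The confidence width at epoch `t`. -/
noncomputable def width (σ α : ℝ) (t : ℕ) (s : Stats K N) (j : Fin K) (i : Fin N) : ℝ :=
  √(1 / (s.pulls j i : ℝ) * (2 * σ ^ 2 * Real.log ((t : ℝ) ^ α)))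

/-- Upper confidence bounds at epoch `t`. -/
noncomputable def ucb (σ α : ℝ) (t : ℕ) (s : Stats K N) (j : Fin K) (i : Fin N) : ℝ :=
  s.empMean j i + s.width σ α t j i

/-- Lower confidence bounds at epoch `t`. -/
noncomputable def lcb (σ α : ℝ) (t : ℕ) (s : Stats K N) (j : Fin K) (i : Fin N) : ℝ :=
  s.empMean j i - s.width σ α t j i

end Stats

namespace Config

variable {K N : ℕ}

/-- The allocation and the pulled arm at epoch `r + 1`, given the statistics `s` of the first `r`
epochs. During the first `N * K` epochs each arm is pulled once. Afterwards the allocation is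
max-min optimal for the upper confidence bounds, and the arm in it with the lowest lower confidence
bound is pulled. -/
noncomputable def act (A : Config K N) (r : ℕ) (s : Stats K N) : Allocation K N × Arm K N :=
  if h : r < N * K then (A.initAlloc ⟨r, h⟩, A.initArm ⟨r, h⟩)
  else
    let φ := A.oracle₁ (s.ucb A.σ A.α (r + 1))
    let j := A.oracle₂ φ (s.lcb A.σ A.α (r + 1))
    (φ, (j, φ j))

/-- The statistics after the first `r` epochs, where `x r j i` is the reward that agent `j` would
receive from good `i` at epoch `r + 1`; only the reward of the pulled arm is observed. -/
noncomputable def stats (A : Config K N) (x : ℕ → Fin K → Fin N → ℝ) : ℕ → Stats K N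
  | 0 => Stats.empty
  | r + 1 =>
    let s := stats A x r
    let a := (A.act r s).2
    s.record a (x r a.1 a.2)

/-- The allocation selected by the Dueling ULCB algorithm at epoch `r + 1`. -/
noncomputable def alloc (A : Config K N) (x : ℕ → Fin K → Fin N → ℝ) (r : ℕ) : Allocation K N :=
  (A.act r (A.stats x r)).1

/-- The cumulative regret of Dueling ULCB over the epochs `1, …, T`, for true rewards `μ` and
realized rewards `x`. -/
noncomputable def regret (A : Config K N) (μ : Fin K → Fin N → ℝ) (x : ℕ → Fin K → Fin N → ℝ)
    (T : ℕ) : ℝ :=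
  ∑ r ∈ Finset.range T, (maxMin μ - minReward μ (A.alloc x r))

end Config

end FairBandit

/-! At an epoch where every confidence interval contains its true reward, optimism makes the
smallest upper bound along the selected allocation at least the max-min value. The pulled arm has
the smallest lower bound along that allocation, so this lower bound is at most the allocation's true
min reward. Both bounds can be read at the pulled arm, so the gap is at most twice the width of the
arm being explored (`maxMin_sub_minReward_le_two_mul_width`). Widths decay like the inverse root of
the pull count, so they sum to order √(NKT log T) (`sum_one_div_sqrt_pulls_le`), with no assumption
on gaps.

The same epochs also cost at most `Δmax * T`. Interpolating the two bounds with weights 1/3 and 2/3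
gives the stated T^(2/3) term.

The other epochs cost at most `Δmax` each. There are at most NK initial ones. After them, some
interval fails at epoch t with probability at most 2NK t^(1-α) (`measure_misses_le`), which is
summable since α > 2. Pull counts are random and depend on past rewards, so the tail bound rests on
an exponential supermartingale (`lintegral_expNoise_le_one`) and a union over the possible counts.
-/

namespace FairBandit

/-! ### Max-min rewards -/

section MaxMin

variable {K N : ℕ}

lemma minReward_le (x : Fin K → Fin N → ℝ) (φ : Allocation K N) (j : Fin K) :
    minReward x φ ≤ x j (φ j) :=
  ciInf_le (Set.finite_range _).bddBelow j

lemma le_minReward (hK : 0 < K) {x : Fin K → Fin N → ℝ} {φ : Allocation K N} {c : ℝ}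
    (h : ∀ j, c ≤ x j (φ j)) : c ≤ minReward x φ :=
  have : Nonempty (Fin K) := ⟨⟨0, hK⟩⟩
  le_ciInf h

lemma minReward_le_maxMin (x : Fin K → Fin N → ℝ) (φ : Allocation K N) :
    minReward x φ ≤ maxMin x :=
  le_ciSup (Set.finite_range (minReward x)).bddAbove φ

lemma maxMin_le (hKN : K ≤ N) {x : Fin K → Fin N → ℝ} {c : ℝ}
    (h : ∀ φ : Allocation K N, minReward x φ ≤ c) : maxMin x ≤ c :=
  have : Nonempty (Allocation K N) := ⟨Fin.castLEEmb hKN⟩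
  ciSup_le h

lemma maxMin_sub_minReward_le (hK : 0 < K) (hKN : K ≤ N) {μ : Fin K → Fin N → ℝ} {Δmax : ℝ}
    (hμ : ∀ j₁ j₂ i₁ i₂, |μ j₁ i₁ - μ j₂ i₂| ≤ Δmax) (φ : Allocation K N) :
    maxMin μ - minReward μ φ ≤ Δmax := by
  have h : maxMin μ - Δmax ≤ minReward μ φ := by
    refine le_minReward hK fun j => ?_
    have : maxMin μ ≤ μ j (φ j) + Δmax := by
      refine maxMin_le hKN fun ψ => (minReward_le μ ψ j).trans ?_
      linarith [(abs_le.1 (hμ j j (ψ j) (φ j))).2]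
    linarith
  linarith

/-- If both oracles act on confidence bounds `m ± w` that are valid for `μ`, then the gap of the
selected allocation is at most twice the confidence width of the selected arm. -/
lemma maxMin_sub_minReward_le_two_mul_width (hK : 0 < K) (hKN : K ≤ N)
    {O₁ : (Fin K → Fin N → ℝ) → Allocation K N} {O₂ : Allocation K N → (Fin K → Fin N → ℝ) → Fin K}
    (hO₁ : IsMaxMinOracle O₁) (hO₂ : IsMinOracle O₂) {μ u l w : Fin K → Fin N → ℝ}
    (hu : ∀ j i, μ j i ≤ u j i) (hl : ∀ j i, l j i ≤ μ j i)
    (hw : ∀ j i, u j i - l j i = 2 * w j i) :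
    maxMin μ - minReward μ (O₁ u) ≤ 2 * w (O₂ (O₁ u) l) (O₁ u (O₂ (O₁ u) l)) := by
  have h₁ : maxMin μ ≤ minReward u (O₁ u) := by
    refine maxMin_le hKN fun ψ => le_trans ?_ (hO₁.optimal u ψ)
    exact le_minReward hK fun j => (minReward_le μ ψ j).trans (hu _ _)
  -- `h₂` and `h₃` evaluate the upper and the lower bound at the same arm, so their difference is a
  -- single interval length.
  have h₂ := minReward_le u (O₁ u) (O₂ (O₁ u) l)
  have h₃ : l (O₂ (O₁ u) l) (O₁ u (O₂ (O₁ u) l)) ≤ minReward μ (O₁ u) :=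
    le_minReward hK fun j => (hO₂.minimal (O₁ u) l j).trans (hl _ _)
  linarith [hw (O₂ (O₁ u) l) (O₁ u (O₂ (O₁ u) l))]

end MaxMin

namespace Config

variable {K N : ℕ}

/-- The arm pulled at epoch `r + 1`. -/
noncomputable def arm (A : Config K N) (x : ℕ → Fin K → Fin N → ℝ) (r : ℕ) : Arm K N :=
  (A.act r (A.stats x r)).2

/-! ### Pull counts -/

section Pulls

variable (A : Config K N) (x : ℕ → Fin K → Fin N → ℝ)

lemma pulls_succ (r : ℕ) (j : Fin K) (i : Fin N) :
    (A.stats x (r + 1)).pulls j i =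
      (A.stats x r).pulls j i + if (j, i) = A.arm x r then 1 else 0 := by
  change (if (j, i) = A.arm x r then _ + 1 else _) = _
  split_ifs <;> rfl

lemma total_succ (r : ℕ) (j : Fin K) (i : Fin N) :
    (A.stats x (r + 1)).total j i =
      (A.stats x r).total j i + if (j, i) = A.arm x r then x r j i else 0 := by
  change (if (j, i) = A.arm x r then _ + x r (A.arm x r).1 (A.arm x r).2 else _) = _
  split_ifs with h
  · simp [← h]
  · simp

lemma pulls_mono (j : Fin K) (i : Fin N) : Monotone fun r => (A.stats x r).pulls j i :=
  monotone_nat_of_le_succ fun r => by rw [pulls_succ]; exact Nat.le_add_right _ _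

lemma pulls_le (r : ℕ) (j : Fin K) (i : Fin N) : (A.stats x r).pulls j i ≤ r := by
  induction r with
  | zero => exact le_rfl
  | succ r ih => rw [pulls_succ]; split_ifs <;> omega

lemma sum_pulls (r : ℕ) : ∑ a : Arm K N, (A.stats x r).pulls a.1 a.2 = r := by
  induction r with
  | zero => simp [stats, Stats.empty]
  | succ r ih => simp [pulls_succ, Finset.sum_add_distrib, ih]

/-- The initial phase enumerates all arms. Later widths are therefore genuine, not the value 0 that
division by zero would give. -/
lemma pulls_pos {r : ℕ} (hr : N * K ≤ r) (j : Fin K) (i : Fin N) :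
    0 < (A.stats x r).pulls j i := by
  obtain ⟨k, hk⟩ := A.initArm.surjective (j, i)
  have harm : A.arm x k = (j, i) := by simp [arm, act, hk]
  have h : (k : ℕ) + 1 ≤ r := by have := k.2; omega
  refine lt_of_lt_of_le ?_ (A.pulls_mono x j i h)
  simp [pulls_succ, harm]

/-- One pull increases the potential 2√(count - 1) by at least the inverse root of the old count. A
first pull has `1 / √0 = 0`, and truncated subtraction makes the right side vanish too. -/
lemma one_div_sqrt_le_two_mul_sub (n : ℕ) :
    1 / √(n : ℝ) ≤ 2 * (√((n + 1 - 1 : ℕ) : ℝ) - √((n - 1 : ℕ) : ℝ)) := by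
  rcases n with _ | n
  · simp
  · have h₁ : 0 < √((n + 1 : ℕ) : ℝ) := Real.sqrt_pos.2 (by positivity)
    have h₂ : √((n + 1 : ℕ) : ℝ) ^ 2 = n + 1 := by rw [Real.sq_sqrt (by positivity)]; simp
    have h₃ : √(n : ℝ) ^ 2 = n := Real.sq_sqrt (by positivity)
    simp only [Nat.add_sub_cancel]
    rw [div_le_iff₀ h₁]
    nlinarith [sq_nonneg (√((n + 1 : ℕ) : ℝ) - √(n : ℝ))]

lemma sum_one_div_sqrt_pulls_le_potential (T : ℕ) :
    ∑ r ∈ Finset.range T, 1 / √((A.stats x r).pulls (A.arm x r).1 (A.arm x r).2 : ℝ) ≤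
      2 * ∑ a : Arm K N, √(((A.stats x T).pulls a.1 a.2 - 1 : ℕ) : ℝ) := by
  induction T with
  | zero => simp [stats, Stats.empty]
  | succ T ih =>
    rw [Finset.sum_range_succ]
    have key : ∑ a : Arm K N, √(((A.stats x (T + 1)).pulls a.1 a.2 - 1 : ℕ) : ℝ) -
        ∑ a : Arm K N, √(((A.stats x T).pulls a.1 a.2 - 1 : ℕ) : ℝ) =
        √(((A.stats x T).pulls (A.arm x T).1 (A.arm x T).2 + 1 - 1 : ℕ) : ℝ) -
        √(((A.stats x T).pulls (A.arm x T).1 (A.arm x T).2 - 1 : ℕ) : ℝ) := by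
      rw [← Finset.sum_sub_distrib, Finset.sum_eq_single (A.arm x T)]
      · simp [pulls_succ]
      · intro a _ ha
        simp [pulls_succ, ha]
      · simp
    have := one_div_sqrt_le_two_mul_sub ((A.stats x T).pulls (A.arm x T).1 (A.arm x T).2)
    linarith

lemma sum_one_div_sqrt_pulls_le (T : ℕ) :
    ∑ r ∈ Finset.range T, 1 / √((A.stats x r).pulls (A.arm x r).1 (A.arm x r).2 : ℝ) ≤
      2 * √((N : ℝ) * K * T) := by
  refine (A.sum_one_div_sqrt_pulls_le_potential x T).trans ?_
  refine mul_le_mul_of_nonneg_left (Real.le_sqrt_of_sq_le ?_) zero_le_two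
  -- Cauchy–Schwarz over the NK arms; the counts add up to T.
  refine sq_sum_le_card_mul_sum_sq.trans ?_
  have h : ∑ a : Arm K N, √(((A.stats x T).pulls a.1 a.2 - 1 : ℕ) : ℝ) ^ 2 ≤ T := by
    calc _ ≤ ∑ a : Arm K N, ((A.stats x T).pulls a.1 a.2 : ℝ) := by
          refine Finset.sum_le_sum fun a _ => ?_
          rw [Real.sq_sqrt (by positivity)]
          exact_mod_cast Nat.sub_le _ _
      _ = T := by exact_mod_cast A.sum_pulls x T
  have hc : ((Finset.univ : Finset (Arm K N)).card : ℝ) = N * K := by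
    simp [Arm, mul_comm]
  rw [hc]
  gcongr

end Pulls

/-! ### The regret when the confidence bounds are valid -/

section Regret

variable (A : Config K N) (x : ℕ → Fin K → Fin N → ℝ) (μ : Fin K → Fin N → ℝ)

/-- Some confidence interval of epoch `r + 1` misses the true reward. -/
def Misses (r : ℕ) : Prop :=
  ∃ j i, (A.stats x r).width A.σ A.α (r + 1) j i < |(A.stats x r).empMean j i - μ j i|

lemma gap_le_two_mul_width (hK : 0 < K) (hKN : K ≤ N)
    (hO₁ : IsMaxMinOracle A.oracle₁) (hO₂ : IsMinOracle A.oracle₂) {r : ℕ} (hr : N * K ≤ r)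
    (h : ¬ A.Misses x μ r) :
    maxMin μ - minReward μ (A.alloc x r) ≤
      2 * (A.stats x r).width A.σ A.α (r + 1) (A.arm x r).1 (A.arm x r).2 := by
  simp only [Misses, not_exists, not_lt] at h
  have hnot : ¬ r < N * K := not_lt.2 hr
  simp only [alloc, arm, act, hnot, dite_false]
  refine maxMin_sub_minReward_le_two_mul_width hK hKN hO₁ hO₂ (fun j i => ?_) (fun j i => ?_)
    (fun j i => ?_)
  · simp only [Stats.ucb]
    linarith [(abs_le.1 (h j i)).1]
  · simp only [Stats.lcb]
    linarith [(abs_le.1 (h j i)).2]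
  · simp only [Stats.ucb, Stats.lcb]; ring

lemma width_le {r T : ℕ} (hα : 0 < A.α) (hr : r < T) (j : Fin K) (i : Fin N) :
    (A.stats x r).width A.σ A.α (r + 1) j i ≤
      √(2 * A.σ ^ 2 * (A.α * Real.log T)) * (1 / √((A.stats x r).pulls j i : ℝ)) := by
  have h : √(1 / ((A.stats x r).pulls j i : ℝ)) = 1 / √((A.stats x r).pulls j i : ℝ) := by
    rw [Real.sqrt_div zero_le_one, Real.sqrt_one]
  rw [Stats.width, Real.sqrt_mul (by positivity), h, mul_comm,
    Real.log_rpow (by positivity)]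
  gcongr
  exact_mod_cast hr

open Classical in
lemma regret_le (hK : 0 < K) (hKN : K ≤ N) (hα : 0 < A.α)
    (hO₁ : IsMaxMinOracle A.oracle₁) (hO₂ : IsMinOracle A.oracle₂) {Δmax : ℝ} (hΔ : 0 < Δmax)
    (hμ : ∀ j₁ j₂ i₁ i₂, |μ j₁ i₁ - μ j₂ i₂| ≤ Δmax) (T : ℕ) :
    A.regret μ x T ≤ Δmax * (N * K) +
      Δmax * ∑ r ∈ Finset.range T, (if N * K ≤ r ∧ A.Misses x μ r then 1 else 0) +
      min (Δmax * T) (4 * √(2 * A.σ ^ 2 * (A.α * Real.log T)) * √((N : ℝ) * K * T)) := by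
  -- Epochs are split into initial, failed and good ones; `g` carries the regret of the good ones.
  set g : ℕ → ℝ := fun r => if N * K ≤ r ∧ ¬ A.Misses x μ r then
    maxMin μ - minReward μ (A.alloc x r) else 0 with hg
  have hgap := fun r => maxMin_sub_minReward_le hK hKN hμ (A.alloc x r)
  have hdec : A.regret μ x T ≤ ∑ r ∈ Finset.range T, (if r < N * K then Δmax else 0) +
      Δmax * ∑ r ∈ Finset.range T, (if N * K ≤ r ∧ A.Misses x μ r then 1 else 0) +
      ∑ r ∈ Finset.range T, g r := by
    rw [regret, Finset.mul_sum, ← Finset.sum_add_distrib, ← Finset.sum_add_distrib]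
    refine Finset.sum_le_sum fun r _ => ?_
    have := hgap r
    by_cases h₁ : r < N * K
    · simpa [hg, h₁, not_le.2 h₁] using this
    · by_cases h₂ : A.Misses x μ r <;> simp [hg, h₁, h₂, not_lt.1 h₁, this]
  have hinit : ∑ r ∈ Finset.range T, (if r < N * K then Δmax else 0) ≤ Δmax * (N * K) := by
    rw [← Finset.sum_filter, Finset.sum_const, nsmul_eq_mul, mul_comm]
    gcongr
    calc ((Finset.filter (fun r => r < N * K) (Finset.range T)).card : ℝ)
        ≤ ((Finset.range (N * K)).card : ℝ) := by
          gcongr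
          intro r
          simp
      _ = N * K := by simp
  have hgood : ∑ r ∈ Finset.range T, g r ≤
      min (Δmax * T) (4 * √(2 * A.σ ^ 2 * (A.α * Real.log T)) * √((N : ℝ) * K * T)) := by
    refine le_min ?_ ?_
    · calc ∑ r ∈ Finset.range T, g r ≤ ∑ r ∈ Finset.range T, Δmax := by
            refine Finset.sum_le_sum fun r _ => ?_
            simp only [hg]
            split_ifs
            · exact hgap r
            · exact hΔ.le
        _ = Δmax * T := by simp [mul_comm]
    · calc ∑ r ∈ Finset.range T, g r
          ≤ ∑ r ∈ Finset.range T, 2 * √(2 * A.σ ^ 2 * (A.α * Real.log T)) *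
              (1 / √((A.stats x r).pulls (A.arm x r).1 (A.arm x r).2 : ℝ)) := by
            refine Finset.sum_le_sum fun r hr => ?_
            simp only [hg]
            split_ifs with h
            · linarith [A.gap_le_two_mul_width x μ hK hKN hO₁ hO₂ h.1 h.2,
                A.width_le x hα (Finset.mem_range.1 hr) (A.arm x r).1 (A.arm x r).2]
            · positivity
        _ ≤ 2 * √(2 * A.σ ^ 2 * (A.α * Real.log T)) * (2 * √((N : ℝ) * K * T)) := by
            rw [← Finset.mul_sum]
            gcongr
            exact A.sum_one_div_sqrt_pulls_le x T
        _ = _ := by ring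
  linarith

lemma regret_nonneg (T : ℕ) : 0 ≤ A.regret μ x T :=
  Finset.sum_nonneg fun _ _ => sub_nonneg.2 (minReward_le_maxMin μ _)

end Regret

end Config

/-! ### Two real inequalities -/

/-- The minimum is at most the weighted geometric mean a^(1/3) b^(2/3). -/
lemma min_le_of_pow_three {a b c : ℝ} (ha : 0 ≤ a) (hb : 0 ≤ b) (hc : 0 ≤ c)
    (h : a * b ^ 2 ≤ c ^ 3) : min a b ≤ c := by
  refine le_of_pow_le_pow_left₀ three_ne_zero hc (le_trans ?_ h)
  have h₀ : 0 ≤ min a b := le_min ha hb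
  calc min a b ^ 3 = min a b * min a b ^ 2 := by ring
    _ ≤ a * b ^ 2 := by
      gcongr
      · exact min_le_left _ _
      · exact min_le_right _ _

lemma sum_rpow_le {p : ℝ} (hp : 1 < p) (T : ℕ) :
    ∑ r ∈ Finset.range T, ((r : ℝ) + 1) ^ (-p) ≤ p / (p - 1) := by
  have hq : 0 < p - 1 := sub_pos.2 hp
  -- The right side is the integral of s^(-p) over [t, t + 1], so the sum telescopes. The inequality
  -- follows from log y ≤ y - 1 and 1 + y ≤ exp y.
  have step : ∀ t : ℝ, 1 ≤ t →
      (t + 1) ^ (-p) ≤ t ^ (-(p - 1)) / (p - 1) - (t + 1) ^ (-(p - 1)) / (p - 1) := by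
    intro t ht
    have ht0 : 0 < t := by linarith
    have ht1 : 0 < t + 1 := by linarith
    have h₁ : (t + 1) ^ (-p) = (t + 1) ^ (-(p - 1)) * (t + 1)⁻¹ := by
      rw [← Real.rpow_neg_one (t + 1), ← Real.rpow_add ht1]; congr 1; ring
    have h₂ : t ^ (-(p - 1)) = (t + 1) ^ (-(p - 1)) * (t / (t + 1)) ^ (-(p - 1)) := by
      rw [← Real.mul_rpow ht1.le (by positivity), mul_div_cancel₀ _ ht1.ne']
    have h₃ : 1 + (p - 1) * (t + 1)⁻¹ ≤ (t / (t + 1)) ^ (-(p - 1)) := by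
      have hlog : Real.log (t / (t + 1)) ≤ -(t + 1)⁻¹ := by
        refine (Real.log_le_sub_one_of_pos (by positivity)).trans (le_of_eq ?_)
        field_simp
        ring
      rw [Real.rpow_def_of_pos (by positivity)]
      refine le_trans ?_ (Real.add_one_le_exp _)
      nlinarith
    rw [← sub_div, le_div_iff₀ hq, h₁, h₂]
    have h₄ : 0 < (t + 1) ^ (-(p - 1)) := Real.rpow_pos_of_pos ht1 _
    nlinarith
  have main : ∀ T : ℕ, ∑ r ∈ Finset.range (T + 1), ((r : ℝ) + 1) ^ (-p) ≤
      p / (p - 1) - ((T : ℝ) + 1) ^ (-(p - 1)) / (p - 1) := by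
    intro T
    induction T with
    | zero =>
      have : p / (p - 1) - 1 / (p - 1) = 1 := by rw [← sub_div, div_self hq.ne']
      simp only [zero_add, Finset.sum_range_one, Nat.cast_zero, Real.one_rpow, this, le_refl]
    | succ T ih =>
      rw [Finset.sum_range_succ]
      have := step ((T : ℝ) + 1) (by linarith [Nat.cast_nonneg (α := ℝ) T])
      push_cast at this ⊢
      linarith
  rcases T with _ | T
  · simp only [Finset.range_zero, Finset.sum_empty]
    have : 0 < p := by linarith
    positivity
  · refine (main T).trans (sub_le_self _ ?_)
    positivity

namespace Config

variable {K N : ℕ}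

/-! ### Measurability -/

section Measurability

variable {Ω : Type*} [MeasurableSpace Ω] (A : Config K N)

instance : MeasurableSpace (Allocation K N) := ⊤

instance : DiscreteMeasurableSpace (Allocation K N) := ⟨fun _ => trivial⟩

lemma measurable_empMean {s : Ω → Stats K N} {j : Fin K} {i : Fin N}
    (hp : Measurable fun ω => (s ω).pulls j i) (ht : Measurable fun ω => (s ω).total j i) :
    Measurable fun ω => (s ω).empMean j i :=
  ht.div (measurable_from_top.comp hp)

lemma measurable_width {s : Ω → Stats K N} {j : Fin K} {i : Fin N}
    (hp : Measurable fun ω => (s ω).pulls j i) (σ α : ℝ) (t : ℕ) :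
    Measurable fun ω => (s ω).width σ α t j i :=
  (((measurable_from_top (f := ((↑) : ℕ → ℝ)).comp hp).const_div 1).mul_const _).sqrt

lemma measurable_act (hO₁ : IsMaxMinOracle A.oracle₁) (hO₂ : IsMinOracle A.oracle₂)
    {s : Ω → Stats K N} (hp : ∀ j i, Measurable fun ω => (s ω).pulls j i)
    (ht : ∀ j i, Measurable fun ω => (s ω).total j i) (r : ℕ) :
    Measurable fun ω => A.act r (s ω) := by
  by_cases h : r < N * K
  · simp only [act, h, dite_true, measurable_const]
  have hm := fun j i => measurable_empMean (hp j i) (ht j i)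
  have hw := fun j i => measurable_width (hp j i) A.σ A.α (r + 1)
  have hu : Measurable fun ω => (s ω).ucb A.σ A.α (r + 1) :=
    measurable_pi_lambda _ fun j => measurable_pi_lambda _ fun i => (hm j i).add (hw j i)
  have hl : Measurable fun ω => (s ω).lcb A.σ A.α (r + 1) :=
    measurable_pi_lambda _ fun j => measurable_pi_lambda _ fun i => (hm j i).sub (hw j i)
  have hφ : Measurable fun ω => A.oracle₁ ((s ω).ucb A.σ A.α (r + 1)) :=
    (measurable_to_countable' hO₁.measurable).comp hu
  have hj : Measurable fun ω =>
      A.oracle₂ (A.oracle₁ ((s ω).ucb A.σ A.α (r + 1))) ((s ω).lcb A.σ A.α (r + 1)) :=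
    (measurable_from_prod_countable_right (f := fun p : Allocation K N × (Fin K → Fin N → ℝ) =>
      A.oracle₂ p.1 p.2) hO₂.measurable).comp (hφ.prodMk hl)
  have hi : Measurable fun p : Allocation K N × Fin K => (p.1, (p.2, p.1 p.2)) :=
    Measurable.of_discrete
  simp only [act, h, dite_false]
  exact hi.comp (hφ.prodMk hj)

/-- The statistics of the first `r` epochs are measurable for any σ-algebra that makes the rewards
of these epochs measurable. -/
lemma measurable_stats (hO₁ : IsMaxMinOracle A.oracle₁) (hO₂ : IsMinOracle A.oracle₂)
    {x : Ω → ℕ → Fin K → Fin N → ℝ} {r : ℕ} (hx : ∀ s < r, Measurable fun ω => x ω s) :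
    (∀ j i, Measurable fun ω => (A.stats (x ω) r).pulls j i) ∧
      ∀ j i, Measurable fun ω => (A.stats (x ω) r).total j i := by
  induction r with
  | zero => exact ⟨fun _ _ => measurable_const, fun _ _ => measurable_const⟩
  | succ r ih =>
    obtain ⟨hp, ht⟩ := ih fun s hs => hx s (hs.trans r.lt_succ_self)
    have ha : Measurable fun ω => A.arm (x ω) r := (A.measurable_act hO₁ hO₂ hp ht r).snd
    have hset : ∀ a, MeasurableSet {ω | a = A.arm (x ω) r} := fun a =>
      measurableSet_eq_fun measurable_const ha
    simp only [pulls_succ, total_succ]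
    exact ⟨fun j i => (hp j i).add (Measurable.ite (hset _) measurable_const measurable_const),
      fun j i => (ht j i).add (Measurable.ite (hset _)
        ((measurable_pi_apply i).comp ((measurable_pi_apply j).comp (hx r r.lt_succ_self)))
        measurable_const)⟩

lemma measurable_arm (hO₁ : IsMaxMinOracle A.oracle₁) (hO₂ : IsMinOracle A.oracle₂)
    {x : Ω → ℕ → Fin K → Fin N → ℝ} {r : ℕ} (hx : ∀ s < r, Measurable fun ω => x ω s) :
    Measurable fun ω => A.arm (x ω) r :=
  (A.measurable_act hO₁ hO₂ (A.measurable_stats hO₁ hO₂ hx).1 (A.measurable_stats hO₁ hO₂ hx).2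
    r).snd

lemma measurableSet_eq_arm (hO₁ : IsMaxMinOracle A.oracle₁) (hO₂ : IsMinOracle A.oracle₂)
    {x : Ω → ℕ → Fin K → Fin N → ℝ} {r : ℕ} (hx : ∀ s < r, Measurable fun ω => x ω s)
    (a : Arm K N) : MeasurableSet {ω | a = A.arm (x ω) r} :=
  measurableSet_eq_fun measurable_const (A.measurable_arm hO₁ hO₂ hx)

lemma measurable_regret (hO₁ : IsMaxMinOracle A.oracle₁) (hO₂ : IsMinOracle A.oracle₂)
    {x : Ω → ℕ → Fin K → Fin N → ℝ} (hx : ∀ s, Measurable fun ω => x ω s)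
    (μ : Fin K → Fin N → ℝ) (T : ℕ) : Measurable fun ω => A.regret μ (x ω) T := by
  refine Finset.measurable_sum _ fun r _ => measurable_const.sub ?_
  have h := A.measurable_stats hO₁ hO₂ (r := r) fun s _ => hx s
  exact (Measurable.of_discrete (f := minReward μ)).comp
    (A.measurable_act hO₁ hO₂ h.1 h.2 r).fst

lemma measurableSet_misses (hO₁ : IsMaxMinOracle A.oracle₁) (hO₂ : IsMinOracle A.oracle₂)
    {x : Ω → ℕ → Fin K → Fin N → ℝ} (hx : ∀ s, Measurable fun ω => x ω s)
    (μ : Fin K → Fin N → ℝ) (r : ℕ) : MeasurableSet {ω | A.Misses (x ω) μ r} := by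
  have h := A.measurable_stats hO₁ hO₂ (r := r) fun s _ => hx s
  simp only [Misses, Set.ofPred_exists]
  exact MeasurableSet.iUnion fun j => MeasurableSet.iUnion fun i => measurableSet_lt
    (measurable_width (h.1 j i) _ _ _)
    ((measurable_empMean (h.1 j i) (h.2 j i)).sub_const _).abs

end Measurability

/-! ### Deviations of the empirical means -/

section Deviation

variable {Ω : Type*} (A : Config K N) (μ : Fin K → Fin N → ℝ) (ε : ℕ → Ω → Fin K → Fin N → ℝ)

/-- The rewards realized with true rewards `μ` and noise `ε`. -/
def rewards (ω : Ω) (r : ℕ) (j : Fin K) (i : Fin N) : ℝ := μ j i + ε r ω j i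

/-- The sum of the noise in the rewards observed from an arm in the first `r` epochs. -/
noncomputable def noise (r : ℕ) (j : Fin K) (i : Fin N) (ω : Ω) : ℝ :=
  (A.stats (rewards μ ε ω) r).total j i - (A.stats (rewards μ ε ω) r).pulls j i * μ j i

/-- The exponential supermartingale of the noise observed from an arm. -/
noncomputable def expNoise (l : ℝ) (j : Fin K) (i : Fin N) (r : ℕ) (ω : Ω) : ENNReal :=
  ENNReal.ofReal (Real.exp (l * A.noise μ ε r j i ω -
    l ^ 2 * A.σ ^ 2 / 2 * (A.stats (rewards μ ε ω) r).pulls j i))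

/-- The indicators depend only on the first `r` epochs, and the last factor only on the new noise:
the form in which independence applies. -/
lemma expNoise_succ (l : ℝ) (j : Fin K) (i : Fin N) (r : ℕ) (ω : Ω) :
    A.expNoise μ ε l j i (r + 1) ω =
      {ω | (j, i) = A.arm (rewards μ ε ω) r}ᶜ.indicator (A.expNoise μ ε l j i r) ω +
      {ω | (j, i) = A.arm (rewards μ ε ω) r}.indicator (A.expNoise μ ε l j i r) ω *
        ENNReal.ofReal (Real.exp (l * ε r ω j i - l ^ 2 * A.σ ^ 2 / 2)) := by
  by_cases h : (j, i) = A.arm (rewards μ ε ω) r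
  · simp only [expNoise, noise, pulls_succ, total_succ, Set.indicator, Set.mem_compl_iff,
      Set.mem_ofPred_eq, h, if_true, not_true, if_false, zero_add]
    rw [← ENNReal.ofReal_mul (Real.exp_nonneg _), ← Real.exp_add]
    congr 2
    simp only [rewards]
    push_cast
    ring
  · simp [expNoise, noise, pulls_succ, total_succ, Set.indicator, h]

variable {ε} in
lemma measurable_rewards_of_le {m : MeasurableSpace Ω} {r : ℕ}
    (h : (⨆ s ∈ Set.Iio r, MeasurableSpace.comap (ε s) inferInstance) ≤ m) (s : ℕ) (hs : s < r) :
    Measurable[m] fun ω => rewards μ ε ω s := by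
  have hε : Measurable[m] (ε s) :=
    measurable_iff_comap_le.2 ((le_iSup₂_of_le s hs le_rfl).trans h)
  exact @measurable_pi_lambda _ _ _ m _ _ fun j => @measurable_pi_lambda _ _ _ m _ _ fun i =>
    measurable_const.add ((measurable_pi_apply i).comp ((measurable_pi_apply j).comp hε))

lemma measurable_expNoise (hO₁ : IsMaxMinOracle A.oracle₁) (hO₂ : IsMinOracle A.oracle₂)
    {m : MeasurableSpace Ω} {r : ℕ}
    (hx : ∀ s < r, Measurable[m] fun ω => rewards μ ε ω s) (l : ℝ) (j : Fin K) (i : Fin N) :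
    Measurable[m] (A.expNoise μ ε l j i r) := by
  obtain ⟨hp, ht⟩ := A.measurable_stats hO₁ hO₂ hx
  have hp' : Measurable[m] fun ω => ((A.stats (rewards μ ε ω) r).pulls j i : ℝ) :=
    measurable_from_top.comp (hp j i)
  exact ((((ht j i).sub (hp'.mul_const _)).const_mul _).sub (hp'.const_mul _)).exp.ennreal_ofReal

/-- A deviation of the empirical mean beyond the confidence width is a deviation of the noise, in
one of the two directions. -/
lemma le_mul_noise_of_width_lt (hσ : 0 < A.σ) {r : ℕ} {j : Fin K} {i : Fin N} {ω : Ω} {n : ℕ}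
    (hn : 0 < n) (hp : (A.stats (rewards μ ε ω) r).pulls j i = n) {L : ℝ} (hL : 0 ≤ L)
    (hlog : Real.log (((r + 1 : ℕ) : ℝ) ^ A.α) = L)
    (h : (A.stats (rewards μ ε ω) r).width A.σ A.α (r + 1) j i <
      |(A.stats (rewards μ ε ω) r).empMean j i - μ j i|) :
    L + √(2 * L / (n * A.σ ^ 2)) ^ 2 * A.σ ^ 2 / 2 * n ≤
        √(2 * L / (n * A.σ ^ 2)) * A.noise μ ε r j i ω ∨
      L + (-√(2 * L / (n * A.σ ^ 2))) ^ 2 * A.σ ^ 2 / 2 * n ≤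
        -√(2 * L / (n * A.σ ^ 2)) * A.noise μ ε r j i ω := by
  have hn' : (0 : ℝ) < n := by exact_mod_cast hn
  -- The optimal Chernoff parameter at count `n`: the compensator l²σ²n/2 equals `L`, and the width
  -- equals lσ².
  set l := √(2 * L / (n * A.σ ^ 2)) with hl
  have hsq : l ^ 2 = 2 * L / (n * A.σ ^ 2) := Real.sq_sqrt (by positivity)
  have hleft : L + l ^ 2 * A.σ ^ 2 / 2 * n = 2 * L := by
    rw [hsq]; field_simp; ring
  have hwidth : (A.stats (rewards μ ε ω) r).width A.σ A.α (r + 1) j i = l * A.σ ^ 2 := by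
    rw [Stats.width, hp, hlog, ← Real.sqrt_sq (sq_nonneg A.σ), hl, ← Real.sqrt_mul (by positivity)]
    congr 1
    rw [Real.sqrt_sq (sq_nonneg A.σ)]
    field_simp
  have hnoise : (A.stats (rewards μ ε ω) r).empMean j i - μ j i = A.noise μ ε r j i ω / n := by
    rw [Stats.empMean, noise, hp]; field_simp
  rw [hwidth, hnoise, abs_div, Nat.abs_cast, lt_div_iff₀ hn'] at h
  have hl0 : 0 ≤ l := Real.sqrt_nonneg _
  have hprod : 2 * L ≤ l * |A.noise μ ε r j i ω| := by
    calc 2 * L = l * (l * A.σ ^ 2 * n) := by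
          rw [show l * (l * A.σ ^ 2 * n) = l ^ 2 * (A.σ ^ 2 * n) by ring, hsq]; field_simp
      _ ≤ _ := by gcongr
  rw [neg_sq, hleft]
  rcases abs_cases (A.noise μ ε r j i ω) with ⟨ha, _⟩ | ⟨ha, _⟩
  · left; rwa [ha] at hprod
  · right; rw [ha] at hprod; linarith

variable [mΩ : MeasurableSpace Ω] {P : Measure Ω}

lemma lintegral_exp_le_one {X : Ω → ℝ} (h : HasSubgaussianMGF X ⟨A.σ ^ 2, sq_nonneg A.σ⟩ P)
    (l : ℝ) : ∫⁻ ω, ENNReal.ofReal (Real.exp (l * X ω - l ^ 2 * A.σ ^ 2 / 2)) ∂P ≤ 1 := by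
  have hint : Integrable (fun ω => Real.exp (l * X ω - l ^ 2 * A.σ ^ 2 / 2)) P := by
    simp only [Real.exp_sub]
    exact (h.integrable_exp_mul l).div_const _
  rw [← ofReal_integral_eq_lintegral_ofReal hint (ae_of_all _ fun _ => Real.exp_nonneg _)]
  refine ENNReal.ofReal_le_one.2 ?_
  simp only [Real.exp_sub]
  rw [integral_div, div_le_one (Real.exp_pos _)]
  refine (h.mgf_le l).trans (le_of_eq ?_)
  congr 1
  change A.σ ^ 2 * l ^ 2 / 2 = _
  ring

variable [IsProbabilityMeasure P]

/-- Whether the arm is pulled is decided by the past, and the new noise is independent of it. A pull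
thus multiplies by a factor of mean at most 1, and otherwise nothing changes. -/
lemma lintegral_expNoise_le_one (hO₁ : IsMaxMinOracle A.oracle₁) (hO₂ : IsMinOracle A.oracle₂)
    (hmeas : ∀ r, Measurable (ε r)) (hindep : iIndepFun ε P)
    (hsub : ∀ r j i, HasSubgaussianMGF (fun ω => ε r ω j i) ⟨A.σ ^ 2, sq_nonneg A.σ⟩ P)
    (l : ℝ) (j : Fin K) (i : Fin N) (r : ℕ) : ∫⁻ ω, A.expNoise μ ε l j i r ω ∂P ≤ 1 := by
  induction r with
  | zero => simp [expNoise, noise, stats, Stats.empty]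
  | succ r ih =>
    have hle : ∀ s, MeasurableSpace.comap (ε s) inferInstance ≤ mΩ := fun s =>
      (hmeas s).comap_le
    set past := ⨆ s ∈ Set.Iio r, MeasurableSpace.comap (ε s) inferInstance with hpast
    have hpast_le : past ≤ mΩ := iSup₂_le fun s _ => hle s
    have hx := measurable_rewards_of_le μ hpast.ge
    have hM := A.measurable_expNoise μ ε hO₁ hO₂ hx l j i
    have hset : MeasurableSet[past] {ω | (j, i) = A.arm (rewards μ ε ω) r} :=
      A.measurableSet_eq_arm hO₁ hO₂ hx _
    have hset' : MeasurableSet[mΩ] {ω | (j, i) = A.arm (rewards μ ε ω) r} := hpast_le _ hset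
    have hind : Indep past (MeasurableSpace.comap (ε r) inferInstance) P := by
      have := indep_iSup_of_disjoint hle hindep.iIndep
        (S := Set.Iio r) (T := {r}) (by simp)
      rwa [iSup_singleton] at this
    have hE : Measurable[MeasurableSpace.comap (ε r) inferInstance]
        fun ω => ENNReal.ofReal (Real.exp (l * ε r ω j i - l ^ 2 * A.σ ^ 2 / 2)) :=
      (((((measurable_pi_apply i).comp ((measurable_pi_apply j).comp
        (comap_measurable (ε r)))).const_mul l).sub_const _).exp).ennreal_ofReal
    simp only [expNoise_succ]
    rw [lintegral_add_left ((hM.mono hpast_le le_rfl).indicator hset'.compl),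
      lintegral_mul_eq_lintegral_mul_lintegral_of_independent_measurableSpace hpast_le (hle r)
        hind (hM.indicator hset) hE]
    refine le_trans (add_le_add_right (mul_le_of_le_one_right' (A.lintegral_exp_le_one
      (mΩ := mΩ) (hsub r j i) l)) _) ?_
    -- The pulled and unpulled parts recombine into the previous expectation.
    rw [lintegral_indicator hset'.compl, lintegral_indicator hset',
      add_comm, lintegral_add_compl _ hset']
    exact ih

/-- Markov's inequality: on this event the supermartingale is at least exp L. -/
lemma measure_noise_le (hO₁ : IsMaxMinOracle A.oracle₁) (hO₂ : IsMinOracle A.oracle₂)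
    (hmeas : ∀ r, Measurable (ε r)) (hindep : iIndepFun ε P)
    (hsub : ∀ r j i, HasSubgaussianMGF (fun ω => ε r ω j i) ⟨A.σ ^ 2, sq_nonneg A.σ⟩ P)
    (l : ℝ) (j : Fin K) (i : Fin N) (r n : ℕ) (L : ℝ) :
    P {ω | (A.stats (rewards μ ε ω) r).pulls j i = n ∧
      L + l ^ 2 * A.σ ^ 2 / 2 * n ≤ l * A.noise μ ε r j i ω} ≤ ENNReal.ofReal (Real.exp (-L)) := by
  have hM := A.measurable_expNoise μ ε hO₁ hO₂ (r := r)
    (measurable_rewards_of_le μ (iSup₂_le fun s _ => (hmeas s).comap_le)) l j i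
  have h := (mul_meas_ge_le_lintegral (μ := P) hM (ENNReal.ofReal (Real.exp L))).trans
    (A.lintegral_expNoise_le_one μ ε hO₁ hO₂ hmeas hindep hsub l j i r)
  rw [Real.exp_neg, ENNReal.ofReal_inv_of_pos (Real.exp_pos _)]
  refine le_trans (measure_mono ?_) (ENNReal.le_inv_iff_mul_le.2 (by rwa [mul_comm]))
  rintro ω ⟨h₁, h₂⟩
  refine ENNReal.ofReal_le_ofReal (Real.exp_le_exp.2 ?_)
  rw [h₁]
  linarith

/-- Union bound over NK arms, two signs and the counts 1, …, r, needed because the Chernoff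
parameter depends on the count. Each event has probability at most (r + 1)^(-α), and the counts cost
one power of r + 1. -/
lemma measure_misses_le (hσ : 0 < A.σ) (hα : 0 < A.α)
    (hO₁ : IsMaxMinOracle A.oracle₁) (hO₂ : IsMinOracle A.oracle₂)
    (hmeas : ∀ r, Measurable (ε r)) (hindep : iIndepFun ε P)
    (hsub : ∀ r j i, HasSubgaussianMGF (fun ω => ε r ω j i) ⟨A.σ ^ 2, sq_nonneg A.σ⟩ P)
    {r : ℕ} (hr : N * K ≤ r) :
    P {ω | A.Misses (rewards μ ε ω) μ r} ≤
      ENNReal.ofReal (2 * (N * K) * ((r : ℝ) + 1) ^ (-(A.α - 1))) := by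
  set L := Real.log (((r + 1 : ℕ) : ℝ) ^ A.α) with hL
  have hL0 : 0 ≤ L :=
    Real.log_nonneg (Real.one_le_rpow (by simp) hα.le)
  set l : ℕ → ℝ := fun n => √(2 * L / (n * A.σ ^ 2))
  set D : ℝ → Arm K N → ℕ → Set Ω := fun l a n =>
    {ω | (A.stats (rewards μ ε ω) r).pulls a.1 a.2 = n ∧
      L + l ^ 2 * A.σ ^ 2 / 2 * n ≤ l * A.noise μ ε r a.1 a.2 ω} with hD
  have hsubset : {ω | A.Misses (rewards μ ε ω) μ r} ⊆
      ⋃ a ∈ (Finset.univ : Finset (Arm K N)), ⋃ n ∈ Finset.Icc 1 r,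
        (D (l n) a n ∪ D (-l n) a n) := by
    rintro ω ⟨j, i, h⟩
    have hpos := A.pulls_pos (rewards μ ε ω) hr j i
    simp only [Set.mem_iUnion]
    refine ⟨(j, i), Finset.mem_univ _, _, Finset.mem_Icc.2 ⟨hpos, A.pulls_le _ r j i⟩, ?_⟩
    exact (A.le_mul_noise_of_width_lt μ ε hσ hpos rfl hL0 hL.symm h).imp
      (fun h' => ⟨rfl, h'⟩) (fun h' => ⟨rfl, h'⟩)
  have hDle : ∀ l a n, P (D l a n) ≤ ENNReal.ofReal (Real.exp (-L)) := fun l a n =>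
    A.measure_noise_le μ ε hO₁ hO₂ hmeas hindep hsub l a.1 a.2 r n L
  have hr1 : (0 : ℝ) < (r : ℝ) + 1 := by positivity
  have hexp : Real.exp (-L) = ((r : ℝ) + 1) ^ (-A.α) := by
    rw [hL, Real.exp_neg, Real.exp_log (by positivity), Real.rpow_neg hr1.le]; simp
  calc P {ω | A.Misses (rewards μ ε ω) μ r}
      ≤ ∑ a : Arm K N, ∑ n ∈ Finset.Icc 1 r, (ENNReal.ofReal (Real.exp (-L)) +
          ENNReal.ofReal (Real.exp (-L))) := by
        refine (measure_mono hsubset).trans ((measure_biUnion_finset_le _ _).trans ?_)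
        refine Finset.sum_le_sum fun a _ => (measure_biUnion_finset_le _ _).trans ?_
        exact Finset.sum_le_sum fun n _ =>
          (measure_union_le _ _).trans (add_le_add (hDle _ _ _) (hDle _ _ _))
    _ = ENNReal.ofReal (∑ a : Arm K N, ∑ n ∈ Finset.Icc 1 r,
          (Real.exp (-L) + Real.exp (-L))) := by
        have h0 := Real.exp_nonneg (-L)
        rw [ENNReal.ofReal_sum_of_nonneg fun _ _ => Finset.sum_nonneg fun _ _ => by positivity]
        refine Finset.sum_congr rfl fun a _ => ?_
        rw [ENNReal.ofReal_sum_of_nonneg fun _ _ => by positivity]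
        exact Finset.sum_congr rfl fun n _ => (ENNReal.ofReal_add h0 h0).symm
    _ ≤ _ := by
        refine ENNReal.ofReal_le_ofReal ?_
        have hsplit : ((r : ℝ) + 1) ^ (-(A.α - 1)) = ((r : ℝ) + 1) ^ (-A.α) * (r + 1) := by
          rw [neg_sub, sub_eq_neg_add, Real.rpow_add_one hr1.ne']
        simp only [Finset.sum_const, Finset.card_univ, Fintype.card_prod, Fintype.card_fin,
          Nat.card_Icc, add_tsub_cancel_right, nsmul_eq_mul, hexp, hsplit]
        have h0 : 0 ≤ ((r : ℝ) + 1) ^ (-A.α) := by positivity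
        push_cast
        have : 0 ≤ (N : ℝ) * K * ((r : ℝ) + 1) ^ (-A.α) := by positivity
        nlinarith

end Deviation

end Config

lemma min_regret_bound_le {D σ α c t L : ℝ} (hD : 0 < D) (hα : 0 < α) (hc : 0 ≤ c)
    (ht : 0 ≤ t) (hL : 0 ≤ L) :
    min (D * t) (4 * √(2 * σ ^ 2 * (α * L)) * √(c * t)) ≤
      (4.5 : ℝ) ^ (2 / 3 : ℝ) * (D * c * (√(2 * α) + 2) ^ 2 * σ ^ 2 * L) ^ (1 / 3 : ℝ) *
        t ^ (2 / 3 : ℝ) := by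
  refine min_le_of_pow_three (by positivity) (by positivity) (by positivity) ?_
  have hcube : ∀ {x : ℝ} (p : ℝ), 0 ≤ x → (x ^ p) ^ 3 = x ^ (p * 3) := fun p hx => by
    rw [← Real.rpow_natCast, ← Real.rpow_mul hx]; norm_num
  rw [mul_pow, mul_pow, mul_pow, mul_pow, hcube _ (by norm_num), hcube _ (by positivity),
    hcube _ ht, Real.sq_sqrt (by positivity), Real.sq_sqrt (by positivity)]
  rw [show (2 / 3 : ℝ) * 3 = (2 : ℕ) by norm_num, show (1 / 3 : ℝ) * 3 = (1 : ℕ) by norm_num]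
  simp only [Real.rpow_natCast]
  -- After cubing, 32α must be at most 4.5² (√(2α) + 2)², and already 4.5² · 2α = 40.5α suffices.
  have h₁ : 2 * α ≤ (√(2 * α) + 2) ^ 2 := by
    nlinarith [Real.sq_sqrt (show 0 ≤ 2 * α by positivity), Real.sqrt_nonneg (2 * α)]
  have h₂ : 0 ≤ D * c * σ ^ 2 * L * t ^ 2 := by positivity
  nlinarith [mul_le_mul_of_nonneg_left h₁ h₂, mul_nonneg h₂ hα.le]

end FairBandit

theorem mainTheorem8 {Ω : Type*} [MeasurableSpace Ω] (P : Measure Ω) [IsProbabilityMeasure P]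
    (K N : ℕ) (hK : 0 < K) (hKN : K ≤ N)
    -- the algorithm
    (A : FairBandit.Config K N) (hσ : 0 < A.σ) (hα : 2 < A.α)
    (hO₁ : FairBandit.IsMaxMinOracle A.oracle₁) (hO₂ : FairBandit.IsMinOracle A.oracle₂)
    -- true rewards, whose differences are bounded
    (μ : Fin K → Fin N → ℝ) (Δmax : ℝ) (hΔ : 0 < Δmax)
    (hμ : ∀ j₁ j₂ i₁ i₂, |μ j₁ i₁ - μ j₂ i₂| ≤ Δmax)
    -- noise: `ε r` is the noise matrix of epoch `r + 1`
    (ε : ℕ → Ω → Fin K → Fin N → ℝ) (hmeas : ∀ r, Measurable (ε r))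
    (hindep : iIndepFun ε P) (hident : ∀ r, IdentDistrib (ε r) (ε 0) P P)
    (hsub : ∀ r j i, HasSubgaussianMGF (fun ω => ε r ω j i) ⟨A.σ ^ 2, sq_nonneg A.σ⟩ P)
    (T : ℕ) :
    Integrable (fun ω => A.regret μ (fun r j i => μ j i + ε r ω j i) T) P ∧
    ∫ ω, A.regret μ (fun r j i => μ j i + ε r ω j i) T ∂P ≤
      6 * Δmax * N * K * ((A.α - 1) / (A.α - 2) + 1) +
        (4.5 : ℝ) ^ (2 / 3 : ℝ) *
          (Δmax * N * K * (√(2 * A.α) + 2) ^ 2 * A.σ ^ 2 * Real.log T) ^ (1 / 3 : ℝ) *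
          (T : ℝ) ^ (2 / 3 : ℝ) := by
  classical
  have hα0 : 0 < A.α := by linarith
  set x : Ω → ℕ → Fin K → Fin N → ℝ := FairBandit.Config.rewards μ ε with hx
  have hxm : ∀ s, Measurable fun ω => x ω s := fun s =>
    FairBandit.Config.measurable_rewards_of_le (r := s + 1) μ
      (iSup₂_le fun t _ => (hmeas t).comap_le) s s.lt_succ_self
  have hint : Integrable (fun ω => A.regret μ (x ω) T) P := by
    refine Integrable.of_bound (A.measurable_regret hO₁ hO₂ hxm μ T).aestronglyMeasurable
      (∑ r ∈ Finset.range T, Δmax) (ae_of_all _ fun ω => ?_)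
    rw [Real.norm_of_nonneg (A.regret_nonneg (x ω) μ T)]
    exact Finset.sum_le_sum fun r _ => FairBandit.maxMin_sub_minReward_le hK hKN hμ _
  refine ⟨hint, ?_⟩
  change ∫ ω, A.regret μ (x ω) T ∂P ≤ _
  set B : ℕ → Set Ω := fun r => {ω | N * K ≤ r ∧ A.Misses (x ω) μ r} with hB
  have hBm : ∀ r, MeasurableSet (B r) := fun r =>
    (MeasurableSet.const _).inter (A.measurableSet_misses hO₁ hO₂ hxm μ r)
  have hBP : ∀ r, P.real (B r) ≤ 2 * (N * K) * ((r : ℝ) + 1) ^ (-(A.α - 1)) := by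
    intro r
    refine ENNReal.toReal_le_of_le_ofReal (by positivity) ?_
    by_cases hr : N * K ≤ r
    · refine (measure_mono fun ω hω => hω.2).trans
        (A.measure_misses_le μ ε hσ hα0 hO₁ hO₂ hmeas hindep hsub hr)
    · simp [hB, hr]
  have hBint : ∀ r, Integrable ((B r).indicator fun _ => (1 : ℝ)) P := fun r =>
    (integrable_const _).indicator (hBm r)
  set G := min (Δmax * T) (4 * √(2 * A.σ ^ 2 * (A.α * Real.log T)) * √((N : ℝ) * K * T)) with hG
  have hpoint : ∀ ω, A.regret μ (x ω) T ≤ Δmax * (N * K) + Δmax *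
      ∑ r ∈ Finset.range T, (B r).indicator (fun _ => (1 : ℝ)) ω + G := fun ω => by
    simpa only [hB, Set.indicator_apply, Set.mem_ofPred_eq] using
      A.regret_le (x ω) μ hK hKN hα0 hO₁ hO₂ hΔ hμ T
  have hsumint : Integrable (fun ω => ∑ r ∈ Finset.range T,
      (B r).indicator (fun _ => (1 : ℝ)) ω) P := integrable_finsetSum _ fun r _ => hBint r
  have hbound : ∫ ω, A.regret μ (x ω) T ∂P ≤ Δmax * (N * K) + Δmax *
      ∑ r ∈ Finset.range T, P.real (B r) + G := by
    have hint₁ : Integrable (fun ω => Δmax * (N * K) + Δmax *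
        ∑ r ∈ Finset.range T, (B r).indicator (fun _ => (1 : ℝ)) ω) P :=
      (integrable_const _).add (hsumint.const_mul _)
    refine (integral_mono hint (hint₁.add (integrable_const G)) hpoint).trans (le_of_eq ?_)
    simp only [Pi.add_apply]
    rw [integral_add hint₁ (integrable_const G),
      integral_add (integrable_const _) (hsumint.const_mul _), integral_const,
      integral_const_mul,
      integral_finsetSum _ fun r _ => hBint r]
    simp [integral_indicator, hBm]
  have hsum : ∑ r ∈ Finset.range T, P.real (B r) ≤
      2 * (N * K) * ((A.α - 1) / (A.α - 2)) := by
    refine (Finset.sum_le_sum fun r _ => hBP r).trans ?_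
    rw [← Finset.mul_sum]
    -- Summability requires α - 1 > 1; this is where α > 2 enters.
    have := FairBandit.sum_rpow_le (p := A.α - 1) (by linarith) T
    rw [show A.α - 1 - 1 = A.α - 2 by ring] at this
    gcongr
  have hGle := FairBandit.min_regret_bound_le (D := Δmax) (σ := A.σ) (α := A.α)
    (c := (N : ℝ) * K) (t := T) (L := Real.log T) hΔ hα0 (by positivity) (by positivity)
    (Real.log_natCast_nonneg T)
  rw [← hG, ← mul_assoc Δmax] at hGle
  have hratio : 0 ≤ (A.α - 1) / (A.α - 2) :=
    div_nonneg (by linarith) (by linarith)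
  have hc : 0 ≤ Δmax * N * K := by positivity
  -- The initial phase contributes coefficient 1 and the failures 2(α-1)/(α-2), both within the
  -- factor 6.
  nlinarith [mul_le_mul_of_nonneg_left hsum hΔ.le, mul_nonneg hc hratio]
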